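/- Let $G$ be a group. An element of $G$ is an FC-element if it has only finitely many conjugates in $G$, and $G$ is an FC-group if all its elements are FC-elements. The automorphism orbits of $G$ are the orbits of the natural action of $\mathrm{Aut}(G)$ on $G$; if there are finitely many of them, their number is denoted by $\omega(G)$. Let $p$ be a prime, and let $G$ be an infinite non-abelian FC-group with finitely many automorphism orbits. If $G$ is a $p$-group (that is, every element of $G$ has order a power of $p$), then $G$ has finite exponent and $\exp(G)$ divides $p^{\omega(G)-2}$. -/

import Mathlib

/-- An element of a group is an FC-element if it has only finitely many conjugates. -/
def IsFCElement {G : Type*} [Group G] (g : G) : Prop :=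
  (conjugatesOf g).Finite

/-- A group is an FC-group if each of its elements is an FC-element. -/
def IsFCGroup (G : Type*) [Group G] : Prop :=
  ∀ g : G, IsFCElement g

/-- The set of automorphism orbits of `G`, that is, the orbits of the natural action of the
automorphism group `MulAut G` on `G`. -/
abbrev AutOrbits (G : Type*) [Group G] : Type _ :=
  MulAction.orbitRel.Quotient (MulAut G) G

/-- The number of automorphism orbits of `G` (used for groups with finitely many orbits). -/
noncomputable def autOrbitCount (G : Type*) [Group G] : ℕ :=
  Nat.card (AutOrbits G)

open scoped Pointwise commutatorElement

section FCGroups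

variable {G : Type*} [Group G]

/-! If some `g` has order `p ^ m` with `m ≥ ω - 1`, its powers already meet every orbit, so elements
of equal order are automorphic. The derived subgroup is characteristic, nontrivial and finite
(Neumann, via `IsFCGroup.finite_commutator`), so it contains every element of order `p`. But an
infinite FC-group of exponent dividing `p ^ n` has infinitely many solutions of `x ^ p = 1`
(`IsFCGroup.infinite_setOf_pow_eq_one`), a contradiction. -/

theorem mem_conjugatesOf_iff_exists {g x : G} : x ∈ conjugatesOf g ↔ ∃ c : G, c * g * c⁻¹ = x :=
  isConj_iff

/-- The centralizer of an FC-element has finite index. -/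
theorem IsFCElement.finiteIndex_centralizer {g : G} (hg : IsFCElement g) :
    (Subgroup.centralizer {g}).FiniteIndex := by
  have : Finite (conjugatesOf g) := hg
  let f : G ⧸ Subgroup.centralizer {g} → conjugatesOf g := fun q =>
    ⟨q.out * g * q.out⁻¹, mem_conjugatesOf_iff_exists.2 ⟨q.out, rfl⟩⟩
  have hf : Function.Injective f := by
    intro a b hab
    have h : a.out * g * a.out⁻¹ = b.out * g * b.out⁻¹ := congrArg Subtype.val hab
    rw [← a.out_eq', ← b.out_eq']
    refine QuotientGroup.eq.2 (Subgroup.mem_centralizer_singleton_iff.2 ?_)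
    calc a.out⁻¹ * b.out * g = a.out⁻¹ * (b.out * g * b.out⁻¹) * b.out := by group
      _ = g * (a.out⁻¹ * b.out) := by rw [← h]; group
  have := Finite.of_injective f hf
  exact Subgroup.finiteIndex_of_finite_quotient

/-- In an FC-group the centralizer of a finite set has finite index. -/
theorem IsFCGroup.finiteIndex_centralizer (hG : IsFCGroup G) {S : Set G} (hS : S.Finite) :
    (Subgroup.centralizer S).FiniteIndex := by
  have : Finite S := hS
  rw [Subgroup.centralizer_eq_iInf, iInf_subtype']
  exact Subgroup.finiteIndex_iInf fun s => (hG s).finiteIndex_centralizer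

/-- B. H. Neumann: if the conjugacy classes have bounded finite size, then there are only finitely
many commutators. -/
theorem IsFCGroup.finite_commutatorSet (hG : IsFCGroup G) {x : G}
    (hx : ∀ y : G, (conjugatesOf y).ncard ≤ (conjugatesOf x).ncard) :
    (commutatorSet G).Finite := by
  have hconj : ∀ c : conjugatesOf x, ∃ y : G, y * x * y⁻¹ = c := fun c =>
    mem_conjugatesOf_iff_exists.1 c.2
  choose y hy using hconj
  have : Finite (conjugatesOf x) := hG x
  set C := Subgroup.centralizer (Set.range y)
  have hC : C.FiniteIndex := hG.finiteIndex_centralizer (Set.finite_range y)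
  set F : Set G := conjugatesOf x * (conjugatesOf x)⁻¹
  have hF : F.Finite := (hG x).mul (hG x).inv
  have key : ∀ g ∈ C, ∀ h : G, ⁅g, h⁆ ∈ F := by
    intro g' hg' h
    obtain ⟨g, rfl⟩ : ∃ g, g' = g⁻¹ := ⟨g'⁻¹, by simp⟩
    have hg : g ∈ C := by simpa using hg'
    -- Since `g` commutes with every chosen conjugator, the class of `g * x` contains a translate of
    -- the class of `x`; maximality of the latter forces equality.
    have hsub : (g * ·) '' conjugatesOf x ⊆ conjugatesOf (g * x) := by
      rintro _ ⟨c, hc, rfl⟩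
      refine mem_conjugatesOf_iff_exists.2 ⟨y ⟨c, hc⟩, ?_⟩
      have hcomm : y ⟨c, hc⟩ * g = g * y ⟨c, hc⟩ :=
        Subgroup.mem_centralizer_iff.1 hg _ ⟨_, rfl⟩
      calc y ⟨c, hc⟩ * (g * x) * (y ⟨c, hc⟩)⁻¹
          = y ⟨c, hc⟩ * g * x * (y ⟨c, hc⟩)⁻¹ := by group
        _ = g * (y ⟨c, hc⟩ * x * (y ⟨c, hc⟩)⁻¹) := by rw [hcomm]; group
        _ = g * c := by rw [hy]
    have heq := Set.eq_of_subset_of_ncard_le hsub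
      (by rw [Set.ncard_image_of_injective _ (mul_right_injective g)]; exact hx _) (hG _)
    have hmem : h * (g * x) * h⁻¹ ∈ conjugatesOf (g * x) :=
      mem_conjugatesOf_iff_exists.2 ⟨h, rfl⟩
    rw [← heq] at hmem
    obtain ⟨c, hc, hgc⟩ := hmem
    refine ⟨c, hc, (h * x * h⁻¹)⁻¹,
      Set.inv_mem_inv.2 (mem_conjugatesOf_iff_exists.2 ⟨h, rfl⟩), ?_⟩
    have hgc' : c = g⁻¹ * (h * (g * x) * h⁻¹) := by rw [← hgc]; group
    simp only [hgc', commutatorElement_def]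
    group
  have hfinite : (⋃ q : G ⧸ C, (q.out • F * {q.out⁻¹}) * (q.out • conjugatesOf q.out⁻¹)).Finite :=
    Set.finite_iUnion fun q =>
      ((hF.smul_set).mul (Set.finite_singleton _)).mul (hG _).smul_set
  refine hfinite.subset ?_
  rintro _ ⟨a, h, rfl⟩
  obtain ⟨g, hg⟩ := QuotientGroup.mk_out_eq_mul C a
  set q : G ⧸ C := (a : G ⧸ C)
  have ha : a = q.out * (g : G)⁻¹ := by rw [hg]; group
  -- Splitting off a coset representative leaves a commutator controlled by `key` and a conjugate of
  -- `q.out⁻¹`.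
  have hcomm : ⁅a, h⁆ =
      (q.out • ⁅(g : G)⁻¹, h⁆ * q.out⁻¹) * q.out • (h * q.out⁻¹ * h⁻¹) := by
    generalize q.out = t at ha
    rw [ha]
    simp only [commutatorElement_def, smul_eq_mul]
    group
  rw [hcomm]
  exact Set.mem_iUnion.2 ⟨q, Set.mul_mem_mul (Set.mul_mem_mul
    (Set.smul_mem_smul_set (key _ (C.inv_mem g.2) h)) rfl) (Set.smul_mem_smul_set
      (mem_conjugatesOf_iff_exists.2 ⟨h, rfl⟩))⟩

/-- A group of exponent dividing `p ^ n` which is an infinite FC-group has infinitely many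
elements whose `p`-th power is trivial. -/
theorem IsFCGroup.infinite_setOf_pow_eq_one [Infinite G] (hG : IsFCGroup G) {p n : ℕ}
    (hexp : ∀ x : G, x ^ p ^ n = 1) : {x : G | x ^ p = 1}.Infinite := by
  intro hfin
  -- A maximal commuting set contains its own centralizer. If it is finite, that centralizer is
  -- finite and of finite index, so `G` is finite.
  obtain ⟨S, hS⟩ := zorn_subset {S : Set G | S.Pairwise Commute} fun c hc hchain =>
    ⟨⋃₀ c, (Set.pairwise_sUnion hchain.directedOn).2 hc, fun s hs => Set.subset_sUnion_of_mem hs⟩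
  have hcent : ∀ x ∈ Subgroup.centralizer S, x ∈ S := by
    intro x hx
    have hins : insert x S ∈ {S : Set G | S.Pairwise Commute} :=
      hS.prop.insert fun y hy _ =>
        have h : y * x = x * y := Subgroup.mem_centralizer_iff.1 hx y hy
        ⟨h.symm, h⟩
    exact hS.le_of_ge hins (Set.subset_insert x S) (Set.mem_insert x S)
  have hcomm : ∀ x ∈ S, ∀ y ∈ S, Commute x y := fun x hx y hy => by
    by_cases h : x = y
    · exact h ▸ Commute.refl x
    · exact hS.prop hx hy h
  have hpow : ∀ x ∈ S, ∀ k : ℕ, x ^ k ∈ S := fun x hx k =>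
    hcent _ (Subgroup.mem_centralizer_iff.2 fun y hy => (hcomm y hy x hx).pow_right k)
  have htors : ∀ k : ℕ, {x ∈ S | x ^ p ^ k = 1}.Finite := by
    intro k
    induction k with
    | zero => exact (Set.finite_singleton (1 : G)).subset fun x hx => by simpa using hx.2
    | succ k ih =>
      -- On commuting elements, a fibre of the `p`-th power map lies in a translate of the
      -- `p`-torsion.
      refine Set.Finite.of_finite_fibers (fun x => x ^ p) (ih.subset ?_) ?_
      · rintro _ ⟨x, ⟨hx, hxk⟩, rfl⟩
        exact ⟨hpow x hx p, by rw [← pow_mul, ← pow_succ']; exact hxk⟩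
      · rintro _ ⟨x, ⟨hx, -⟩, rfl⟩
        refine (hfin.image (x * ·)).subset ?_
        rintro y ⟨⟨hy, -⟩, hyx⟩
        have hyx' : y ^ p = x ^ p := hyx
        refine ⟨x⁻¹ * y, ?_, by simp⟩
        change (x⁻¹ * y) ^ p = 1
        rw [((hcomm x hx y hy).inv_left).mul_pow, hyx', inv_pow, inv_mul_cancel]
  have hSfin : S.Finite := (htors n).subset fun x hx => ⟨hx, hexp x⟩
  have hidx := hG.finiteIndex_centralizer hSfin
  have hcfin : Finite (Subgroup.centralizer S) := (hSfin.subset hcent : Set.Finite _)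
  have : Finite G := (Subgroup.finite_iff_finite_and_finiteIndex _).2 ⟨hcfin, hidx⟩
  exact not_finite G

/-- An automorphism preserves the size of conjugacy classes. -/
theorem ncard_conjugatesOf_mulAut (φ : MulAut G) (g : G) :
    (conjugatesOf (φ g)).ncard = (conjugatesOf g).ncard := by
  have : conjugatesOf (φ g) = φ '' conjugatesOf g := by
    ext x
    simp only [Set.mem_image, mem_conjugatesOf_iff_exists]
    constructor
    · rintro ⟨c, rfl⟩
      exact ⟨_, ⟨φ.symm c, rfl⟩, by simp⟩
    · rintro ⟨_, ⟨c, rfl⟩, rfl⟩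
      exact ⟨φ c, by simp⟩
  rw [this, Set.ncard_image_of_injective _ φ.injective]

/-- An FC-group with finitely many automorphism orbits has finite derived subgroup. -/
theorem IsFCGroup.finite_commutator (hG : IsFCGroup G) [Finite (AutOrbits G)] :
    Finite (commutator G) := by
  let f : AutOrbits G → ℕ := Quotient.lift (fun g : G => (conjugatesOf g).ncard) (by
    rintro a b ⟨φ, rfl⟩
    exact ncard_conjugatesOf_mulAut φ b)
  have : Nonempty (AutOrbits G) := ⟨Quotient.mk _ 1⟩
  obtain ⟨q, hq⟩ := Finite.exists_max f
  induction q using Quotient.inductionOn with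
  | h x =>
    have : Finite (commutatorSet G) := hG.finite_commutatorSet fun y => hq (Quotient.mk _ y)
    -- Schur: finitely many commutators generate a finite derived subgroup.
    infer_instance

/-- If some element of a `p`-group has order at least `p ^ (ω - 1)`, where `ω` is the number of
automorphism orbits, then every element is an automorphic image of a power of it. -/
theorem exists_mulAut_pow_eq [Finite (AutOrbits G)] {p m : ℕ} (hp : p.Prime) {g : G}
    (hg : orderOf g = p ^ m) (hm : autOrbitCount G ≤ m + 1) (x : G) :
    ∃ i ≤ m, ∃ φ : MulAut G, orderOf x = p ^ i ∧ φ (g ^ p ^ (m - i)) = x := by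
  have hord : ∀ i ≤ m, orderOf (g ^ p ^ (m - i)) = p ^ i := fun i hi => by
    rw [orderOf_pow_of_dvd (pow_ne_zero _ hp.ne_zero) (hg ▸ pow_dvd_pow p (Nat.sub_le m i)), hg,
      Nat.pow_div (Nat.sub_le m i) hp.pos, Nat.sub_sub_self hi]
  -- These powers of `g` have distinct orders, hence lie in distinct orbits, and there are as many
  -- of them as orbits.
  let f : Fin (autOrbitCount G) → AutOrbits G := fun i => Quotient.mk _ (g ^ p ^ (m - i))
  have hi : ∀ i : Fin (autOrbitCount G), (i : ℕ) ≤ m := fun i => by omega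
  have hf : Function.Injective f := by
    intro i j hij
    obtain ⟨φ, hφ⟩ := Quotient.exact hij
    have h : orderOf (g ^ p ^ (m - j)) = orderOf (g ^ p ^ (m - i)) := by
      rw [← hφ]
      exact (MulEquiv.orderOf_eq φ _).symm
    rw [hord _ (hi i), hord _ (hi j)] at h
    exact Fin.ext (Nat.pow_right_injective hp.two_le h).symm
  obtain ⟨i, hix⟩ := (hf.bijective_of_nat_card_le (by simp [autOrbitCount])).2 (Quotient.mk _ x)
  obtain ⟨φ, hφ⟩ := Quotient.exact hix.symm
  have hφ' : φ (g ^ p ^ (m - i)) = x := hφ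
  exact ⟨i, hi i, φ, by rw [← hφ', MulEquiv.orderOf_eq, hord _ (hi i)], hφ'⟩

end FCGroups

theorem mainTheorem7 {G : Type*} [Group G] [Infinite G] (p : ℕ) (hp : p.Prime)
    (hFC : IsFCGroup G) (hnonab : ¬ ∀ a b : G, a * b = b * a)
    (hfin : Finite (AutOrbits G)) (hpG : IsPGroup p G) :
    Monoid.exponent G ∣ p ^ (autOrbitCount G - 2) := by
  have : Fact p.Prime := ⟨hp⟩
  refine Monoid.exponent_dvd_of_forall_pow_eq_one fun g => ?_
  by_contra hg
  obtain ⟨m, hm⟩ := IsPGroup.iff_orderOf.1 hpG g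
  have hlt : autOrbitCount G - 2 < m := by
    by_contra! h
    exact hg (orderOf_dvd_iff_pow_eq_one.1 (hm ▸ pow_dvd_pow p h))
  have key := exists_mulAut_pow_eq hp hm (by omega)
  have hexp : ∀ x : G, x ^ p ^ m = 1 := fun x => by
    obtain ⟨i, hi, -, hx, -⟩ := key x
    exact orderOf_dvd_iff_pow_eq_one.1 (hx ▸ pow_dvd_pow p hi)
  have hcfin : (commutator G : Set G).Finite := hFC.finite_commutator
  have hne : commutator G ≠ ⊥ := fun h => hnonab fun a b => by
    rw [commutator_eq_bot_iff_center_eq_top] at h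
    exact (Subgroup.mem_center_iff.1 (h ▸ Subgroup.mem_top b : b ∈ Subgroup.center G) a)
  obtain ⟨z, hz, hz1⟩ := (commutator G).bot_or_exists_ne_one.resolve_left hne
  obtain ⟨k, -, -, hk, -⟩ := key z
  have hk0 : k ≠ 0 := by
    rintro rfl
    exact hz1 (orderOf_eq_one_iff.1 (by simpa using hk))
  -- An element of order `p` in the derived subgroup; its orbit is all elements of order `p`.
  set w := z ^ p ^ (k - 1)
  have hw : w ∈ commutator G := pow_mem hz _
  have hwp : orderOf w = p := by
    rw [orderOf_pow_of_dvd (pow_ne_zero _ hp.ne_zero) (hk ▸ pow_dvd_pow p (Nat.sub_le k 1)), hk,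
      Nat.pow_div (Nat.sub_le k 1) hp.pos, Nat.sub_sub_self (Nat.one_le_iff_ne_zero.2 hk0), pow_one]
  refine hFC.infinite_setOf_pow_eq_one hexp
    (hcfin.subset fun x hx => ?_)
  by_cases hx1 : x = 1
  · exact hx1 ▸ one_mem _
  have hxp : orderOf x = p := orderOf_eq_prime hx hx1
  obtain ⟨i, -, φ, hi, hφ⟩ := key x
  obtain ⟨j, -, ψ, hj, hψ⟩ := key w
  have hij : i = j := Nat.pow_right_injective hp.two_le (by
    change p ^ i = p ^ j
    rw [← hi, ← hj, hxp, hwp])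
  subst hij
  have hxw : x = (φ * ψ⁻¹) w := by
    rw [← hφ, ← hψ]
    simp
  rw [hxw]
  exact Subgroup.characteristic_iff_map_le.1 inferInstance (φ * ψ⁻¹) ⟨w, hw, rfl⟩
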